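/- An \emph{almost model category} is a category $\mathcal{C}$ with all small limits and colimits, together with three classes of morphisms, the weak equivalences $\mathcal{W}$, the fibrations $\mathcal{F}$ and the cofibrations $\mathcal{C}of$, such that: all three classes are closed under retracts; $\mathcal{F}$ and $\mathcal{C}of$ contain the identities and are closed under composition; the morphisms in $\mathcal{C}of\cap\mathcal{W}$ have the left lifting property with respect to $\mathcal{F}$, and those in $\mathcal{C}of$ have it with respect to $\mathcal{F}\cap\mathcal{W}$; and there are functorial factorizations of every morphism into a morphism in $\mathcal{C}of\cap\mathcal{W}$ followed by one in $\mathcal{F}$, and into a morphism in $\mathcal{C}of$ followed by one in $\mathcal{F}\cap\mathcal{W}$. It is a \emph{right model category} if moreover $\mathcal{W}$ contains all isomorphisms and, for composable morphisms $X\xrightarrow{f}Z\xrightarrow{g}Y$: (a) if $f,g\in\mathcal{W}$ then $g\circ f\in\mathcal{W}$; (b) if $f,g\circ f\in\mathcal{W}$ then $g\in\mathcal{W}$. Let $\mathcal{S}$ be the category of simplicial sets, with the cartesian product as monoidal structure, the monomorphisms as cofibrations, and as weak equivalences the maps whose geometric realization is a weak homotopy equivalence. A \emph{simplicial right model category} is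 a right model category $\mathcal{C}$ with a left action $\otimes:\mathcal{S}\times\mathcal{C}\to\mathcal{C}$ of the monoidal category $\mathcal{S}$ which is part of a two variable adjunction $$\mathcal{C}(K\otimes A,B)\cong\mathcal{S}(K,\mathrm{Map}(A,B))\cong\mathcal{C}(A,\hom(K,B)),$$ such that for every cofibration $j:X\to Y$ in $\mathcal{S}$ and every cofibration $i:L\to K$ in $\mathcal{C}$ the induced map $X\otimes K\coprod_{X\otimes L}Y\otimes L\to Y\otimes K$ is a cofibration, which is a weak equivalence if $i$ or $j$ is. Then $\mathcal{C}$ is a simplicial category with mapping spaces $\mathrm{Map}(A,B)$, whose vertices are the morphisms $A\to B$ of $\mathcal{C}$. A morphism $f:A\to B$ of $\mathcal{C}$ is called a \emph{simplicial homotopy equivalence} if it is an equivalence in this simplicial category, that is, if there is $g:B\to A$ such that $g\circ f$ and $\mathrm{id}_A$ lie in the same connected component of $\mathrm{Map}(A,A)$, and $f\circ g$ and $\mathrm{id}_B$ lie in the same connected component of $\mathrm{Map}(B,B)$. \textbf{Proposition.} Let $\mathcal{C}$ be a simplicial right model category, and let $f:A\to B$ be a morphism in $\mathcal{C}$ between objects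 that are both fibrant and cofibrant. Then $f$ is a weak equivalence if and only if it is a simplicial homotopy equivalence. -/

import Mathlib

open CategoryTheory Limits HomotopicalAlgebra MonoidalCategory Opposite
open MonoidalCategory.MonoidalLeftAction
open scoped Simplicial Topology.Homotopy

universe v u v₁ v₂ v₃ u₁ u₂ u₃

namespace AlmostModel

/-! ### Almost model categories and right model categories -/

section

variable (C : Type u) [Category.{v} C] [CategoryWithCofibrations C] [CategoryWithFibrations C]
  [CategoryWithWeakEquivalences C]

/-- An almost model category: all the axioms of a model category (in the version with small
limits and colimits and functorial factorizations), except for the two out of three property. -/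
class IsAlmostModelCategory : Prop where
  hasLimits : HasLimits C
  hasColimits : HasColimits C
  weakEquivalences_retracts : (weakEquivalences C).IsStableUnderRetracts
  fibrations_multiplicative : (fibrations C).IsMultiplicative
  fibrations_retracts : (fibrations C).IsStableUnderRetracts
  cofibrations_multiplicative : (cofibrations C).IsMultiplicative
  cofibrations_retracts : (cofibrations C).IsStableUnderRetracts
  trivialCofibrations_lift : trivialCofibrations C ≤ (fibrations C).llp
  cofibrations_lift : cofibrations C ≤ (trivialFibrations C).llp
  factorization_trivialCofibrations :
    MorphismProperty.HasFunctorialFactorization (trivialCofibrations C) (fibrations C)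
  factorization_trivialFibrations :
    MorphismProperty.HasFunctorialFactorization (cofibrations C) (trivialFibrations C)

attribute [instance] IsAlmostModelCategory.hasLimits IsAlmostModelCategory.hasColimits

/-- A right model category: an almost model category whose weak equivalences contain the
isomorphisms, are closed under composition, and satisfy the following cancellation property:
if `f` and `f ≫ g` (that is, `g ∘ f`) are weak equivalences, then so is `g`. -/
class IsRightModelCategory : Prop extends IsAlmostModelCategory C where
  isomorphisms_le : MorphismProperty.isomorphisms C ≤ weakEquivalences C
  weakEquivalence_comp {X Z Y : C} (f : X ⟶ Z) (g : Z ⟶ Y)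
    (hf : WeakEquivalence f) (hg : WeakEquivalence g) : WeakEquivalence (f ≫ g)
  weakEquivalence_of_precomp {X Z Y : C} (f : X ⟶ Z) (g : Z ⟶ Y)
    (hf : WeakEquivalence f) (hfg : WeakEquivalence (f ≫ g)) : WeakEquivalence g

end

/-! ### Weak equivalences of topological spaces and of simplicial sets -/

section

variable {X Y : Type*} [TopologicalSpace X] [TopologicalSpace Y]

/-- The map induced by a continuous map on path components. -/
def mapZerothHomotopy (f : C(X, Y)) : ZerothHomotopy X → ZerothHomotopy Y :=
  Quotient.map f (fun _ _ h ↦ h.map f.continuous)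

/-- The generalized loop `f ∘ p`. -/
def mapGenLoop (N : Type*) (f : C(X, Y)) (x : X) (p : Ω^ N X x) : Ω^ N Y (f x) :=
  ⟨f.comp p.1, fun y hy ↦ congrArg f (p.2 y hy)⟩

/-- The map induced by a continuous map on homotopy groups. -/
def mapHomotopyGroup (N : Type*) (f : C(X, Y)) (x : X) :
    HomotopyGroup N X x → HomotopyGroup N Y (f x) :=
  Quotient.map (mapGenLoop N f x) (fun _ _ h ↦ h.comp_continuousMap f)

/-- A weak homotopy equivalence of topological spaces: a continuous map which induces a bijection
on path components and on all the homotopy groups `π_n`, `n ≥ 1`, at all base points. -/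
structure IsWeakHomotopyEquivalence (f : C(X, Y)) : Prop where
  bijective_zerothHomotopy : Function.Bijective (mapZerothHomotopy f)
  bijective_homotopyGroup (n : ℕ) (x : X) :
    Function.Bijective (mapHomotopyGroup (Fin (n + 1)) f x)

end

/-- The cofibrations of simplicial sets are the monomorphisms. -/
instance cofibrationsSSet : CategoryWithCofibrations SSet.{u} where
  cofibrations := MorphismProperty.monomorphisms _

/-- The weak equivalences of simplicial sets are the maps whose geometric realization is a weak
homotopy equivalence. -/
instance weakEquivalencesSSet : CategoryWithWeakEquivalences SSet.{u} where
  weakEquivalences := fun _ _ f ↦ IsWeakHomotopyEquivalence (SSet.toTop.map f).hom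

/-! ### Two variable adjunctions and left Quillen bifunctors -/

section

variable {B : Type u₁} {C : Type u₂} {D : Type u₃}
  [Category.{v₁} B] [Category.{v₂} C] [Category.{v₃} D]

/-- A two variable adjunction `(F, homR, homL)`: bijections
`(F(b, c) ⟶ d) ≃ (b ⟶ homR(c, d))` and `(F(b, c) ⟶ d) ≃ (c ⟶ homL(b, d))`,
natural in all the variables. -/
structure TwoVariableAdjunction (F : B ⥤ C ⥤ D) where
  /-- the right adjoint in the first variable -/
  homR : Cᵒᵖ ⥤ D ⥤ B
  /-- the right adjoint in the second variable -/
  homL : Bᵒᵖ ⥤ D ⥤ C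
  /-- `(F(b, c) ⟶ d) ≃ (b ⟶ homR(c, d))` -/
  adjR : F.flip ⊣₂ homR
  /-- `(F(b, c) ⟶ d) ≃ (c ⟶ homL(b, d))` -/
  adjL : F ⊣₂ homL

variable [CategoryWithCofibrations B] [CategoryWithWeakEquivalences B]
  [CategoryWithCofibrations C] [CategoryWithWeakEquivalences C]
  [CategoryWithCofibrations D] [CategoryWithWeakEquivalences D]

/-- A left Quillen bifunctor, together with the two variable adjunction that it is a part of.
For cofibrations `j : X ⟶ Y` and `i : L ⟶ K`, the morphism `sq.ι` is the induced map
`F(X, K) ⨿_{F(X, L)} F(Y, L) ⟶ F(Y, K)`. -/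
structure LeftQuillenBifunctor (F : B ⥤ C ⥤ D) extends TwoVariableAdjunction F where
  cofibration_ι {X Y : B} (j : X ⟶ Y) {L K : C} (i : L ⟶ K) (sq : F.PushoutObjObj j i) :
    Cofibration j → Cofibration i → Cofibration sq.ι
  weakEquivalence_ι {X Y : B} (j : X ⟶ Y) {L K : C} (i : L ⟶ K) (sq : F.PushoutObjObj j i) :
    Cofibration j → Cofibration i → (WeakEquivalence j ∨ WeakEquivalence i) →
      WeakEquivalence sq.ι

end

/-! ### The simplicial category attached to a closed action of simplicial sets -/

namespace TwoVariableAdjunction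

variable {C : Type u} [Category.{v} C] [MonoidalLeftAction SSet.{v} C]
  (T : TwoVariableAdjunction (curriedAction SSet.{v} C))

/-- The simplicial mapping space `Map(A, B)`. -/
abbrev map (A B : C) : SSet.{v} := (T.homR.obj (op A)).obj B

/-- The adjunction bijection `(K ⊗ A ⟶ B) ≃ (K ⟶ Map(A, B))`. -/
def curry {K : SSet.{v}} {A B : C} : (K ⊙ₗ A ⟶ B) ≃ (K ⟶ T.map A B) :=
  T.adjR.homEquiv (X₁ := A) (X₂ := K) (X₃ := B)

/-- The evaluation map `Map(A, B) ⊗ A ⟶ B`. -/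
def ev (A B : C) : T.map A B ⊙ₗ A ⟶ B := T.curry.symm (𝟙 _)

lemma curry_comp {K L : SSet.{v}} {A B : C} (f : K ⟶ L) (g : L ⊙ₗ A ⟶ B) :
    f ≫ T.curry g = T.curry (f ⊵ₗ A ≫ g) :=
  (T.adjR.homEquiv_naturality_two f g).symm

lemma curry_ev {K : SSet.{v}} {A B : C} (g : K ⊙ₗ A ⟶ B) :
    T.curry g ⊵ₗ A ≫ T.ev A B = g := by
  apply T.curry.injective
  rw [← curry_comp, ev, Equiv.apply_symm_apply, Category.comp_id]

lemma curry_ev_eq_id (A B : C) : T.curry (T.ev A B) = 𝟙 _ :=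
  T.curry.apply_symm_apply _

/-- The composition `Map(A, B) × Map(B, D) ⟶ Map(A, D)`, adjoint to the map
`(Map(B, D) × Map(A, B)) ⊗ A ≅ Map(B, D) ⊗ (Map(A, B) ⊗ A) ⟶ Map(B, D) ⊗ B ⟶ D`. -/
def mapComp (A B D : C) : T.map A B ⊗ T.map B D ⟶ T.map A D :=
  T.curry ((β_ _ _).hom ⊵ₗ A ≫ (αₗ _ _ _).hom ≫ T.map B D ⊴ₗ T.ev A B ≫ T.ev B D)

lemma tensor_comp_mapComp {K L : SSet.{v}} {A B D : C} (f : K ⊙ₗ A ⟶ B) (g : L ⊙ₗ B ⟶ D) :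
    (T.curry f ⊗ₘ T.curry g) ≫ T.mapComp A B D =
      T.curry ((β_ K L).hom ⊵ₗ A ≫ (αₗ _ _ _).hom ≫ L ⊴ₗ f ≫ g) := by
  rw [mapComp, curry_comp]
  congr 1
  rw [← comp_actionHomLeft_assoc, BraidedCategory.braiding_naturality, comp_actionHomLeft_assoc]
  congr 1
  rw [← actionHom_id, actionAssocIso_hom_naturality_assoc, actionHom_id, actionHom_def]
  congr 1
  rw [Category.assoc, ← actionHomRight_comp_assoc, curry_ev, ← action_exchange_assoc, curry_ev]

/-- The unit `Δ[0] ⟶ Map(A, A)`, adjoint to `Δ[0] ⊗ A ≅ A`. -/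
def mapId (A : C) : 𝟙_ SSet.{v} ⟶ T.map A A := T.curry (λₗ A).hom

/-- The simplicial category with mapping spaces `Map(A, B)`. -/
abbrev simplicialCategory : SimplicialCategory C where
  Hom := T.map
  id := T.mapId
  comp := T.mapComp
  id_comp A B := by
    rw [← T.curry_ev_eq_id A B, ← tensorHom_id, ← T.curry_ev_eq_id A B, mapId,
      tensor_comp_mapComp, curry_comp, ← rightUnitor_actionHom_assoc, ← comp_actionHomLeft_assoc,
      ← comp_actionHomLeft_assoc]
    simp
  comp_id A B := by
    rw [← T.curry_ev_eq_id A B, ← id_tensorHom, ← T.curry_ev_eq_id A B, mapId,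
      tensor_comp_mapComp, curry_comp, ← actionUnitIso_hom_naturality,
      ← leftUnitor_actionHom_assoc, ← comp_actionHomLeft_assoc, ← comp_actionHomLeft_assoc]
    simp
  assoc A B D E := by
    have key : ∀ P Q R : SSet.{v}, (α_ P Q R).inv ≫ (β_ (P ⊗ Q) R).hom ≫ R ◁ (β_ P Q).hom =
        (β_ P (Q ⊗ R)).hom ≫ (β_ Q R).hom ▷ P ≫ (α_ R Q P).hom := by
      intro P Q R
      simp only [BraidedCategory.braiding_tensor_left_hom,
        BraidedCategory.braiding_tensor_right_hom, Category.assoc, Iso.inv_hom_id_assoc]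
      simpa using (BraidedCategory.yang_baxter P Q R).symm
    rw [← id_tensorHom, ← tensorHom_id, ← T.curry_ev_eq_id D E, ← T.curry_ev_eq_id A B,
      show T.mapComp A B D = T.curry _ from rfl, show T.mapComp B D E = T.curry _ from rfl,
      tensor_comp_mapComp, tensor_comp_mapComp, curry_comp]
    congr 1
    generalize T.ev A B = f, T.ev B D = g, T.ev D E = h
    generalize T.map A B = P at *
    generalize T.map B D = Q at *
    generalize T.map D E = R at *
    rw [action_exchange_assoc, actionHomLeft_action, tensor_actionHomRight]
    simp only [actionHomRight_comp, Category.assoc, Iso.inv_hom_id_assoc]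
    have hR : (R ◁ (β_ P Q).hom) ⊵ₗ A ≫ (αₗ R (Q ⊗ P) A).hom =
        (αₗ R (P ⊗ Q) A).hom ≫ R ⊴ₗ (β_ P Q).hom ⊵ₗ A := by
      simp only [whiskerLeft_actionHomLeft, Category.assoc, Iso.inv_hom_id, Category.comp_id]
    rw [← associator_actionHom_assoc, Iso.hom_inv_id_assoc, ← reassoc_of% hR,
      ← comp_actionHomLeft_assoc, ← comp_actionHomLeft_assoc, ← comp_actionHomLeft_assoc,
      ← comp_actionHomLeft_assoc, Category.assoc, key, Category.assoc]
  homEquiv {A B} := (λₗ A).symm.homFromEquiv.trans T.curry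
  homEquiv_id A := by
    simp [mapId, eId]
  homEquiv_comp {A B D} f g := by
    have h : (λ_ (𝟙_ SSet.{v})).inv ⊵ₗ A ≫ (αₗ (𝟙_ SSet.{v}) (𝟙_ SSet.{v}) A).hom ≫
        (λₗ (𝟙_ SSet.{v} ⊙ₗ A)).hom = 𝟙 _ := by
      rw [← leftUnitor_actionHom, ← comp_actionHomLeft, Iso.inv_hom_id, id_actionHomLeft]
    simp [eComp, tensor_comp_mapComp, curry_comp, reassoc_of% h]

end TwoVariableAdjunction

/-! ### Equivalences in a simplicial category -/

section

variable {C : Type u} [Category.{v} C]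

/-- Two morphisms `A ⟶ B` in a simplicial category are homotopic if the corresponding vertices of
the mapping space `Map(A, B)` lie in the same connected component. -/
def AreSimpliciallyHomotopic [SimplicialCategory C] {A B : C} (f g : A ⟶ B) : Prop :=
  SSet.π₀.mk (SimplicialCategory.homEquiv' A B f) = SSet.π₀.mk (SimplicialCategory.homEquiv' A B g)

/-- A morphism in a simplicial category is an equivalence (a simplicial homotopy equivalence) if
it has an inverse up to homotopy. -/
def IsSimplicialEquivalence [SimplicialCategory C] {A B : C} (f : A ⟶ B) : Prop :=
  ∃ g : B ⟶ A, AreSimpliciallyHomotopic (f ≫ g) (𝟙 A) ∧ AreSimpliciallyHomotopic (g ≫ f) (𝟙 B)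

end

/-! ### Simplicial almost model categories -/

section

variable (C : Type u) [Category.{v} C] [CategoryWithCofibrations C] [CategoryWithFibrations C]
  [CategoryWithWeakEquivalences C]

/-- A simplicial almost model category: an almost model category with a left action of the monoidal
category of simplicial sets (with the cartesian product) which is a left Quillen bifunctor with
respect to the standard model structure on simplicial sets. -/
class SimplicialAlmostModelCategory [IsAlmostModelCategory C] extends
    MonoidalLeftAction SSet.{v} C where
  /-- the action is a left Quillen bifunctor -/
  leftQuillen : LeftQuillenBifunctor (curriedAction SSet.{v} C)

variable {C}

/-- A map in a simplicial almost model category is a simplicial homotopy equivalence if it is an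
equivalence in the associated simplicial category. -/
def IsSimplicialHomotopyEquivalence [IsAlmostModelCategory C] [SimplicialAlmostModelCategory C]
    {A B : C} (f : A ⟶ B) : Prop :=
  letI := (SimplicialAlmostModelCategory.leftQuillen (C := C)).simplicialCategory
  IsSimplicialEquivalence f

end

end AlmostModel

open AlmostModel

namespace AlmostModel

/-! ### Spaces homeomorphic to a convex set -/

section

variable {E : Type*} [AddCommGroup E] [Module ℝ E] [TopologicalSpace E]
  [IsTopologicalAddGroup E] [ContinuousSMul ℝ E] {s : Set E}
  {X Y : Type*} [TopologicalSpace X] [TopologicalSpace Y]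

/-! Elementary homotopies `Δ[1] ⊗ A ⟶ B` are the edges of `Map(A, B)`, and they are stable under
composition on both sides. Hence a map is a simplicial homotopy equivalence exactly when it becomes
invertible in the quotient category of homotopy classes (`isSimplicialEquivalence_iff`), and it
remains to compare weak equivalences with maps inverted there.

Factor `f` as a trivial cofibration `i` followed by a fibration `p`; the middle object is again
fibrant and cofibrant. Lifting against the pushout product with `∂Δ[1] ⟶ Δ[1]` shows that `i` is
inverted (`exists_homotopy_lift`). If `f` is a weak equivalence, the available cancellation makes
`p` a trivial fibration, which is inverted by the dual argument. Conversely, if `f` is inverted then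
so is `p`. Homotopy lifting turns a homotopy inverse of `p` into a strict section `s`, and `s ∘ p`,
being homotopic to the identity, is a weak equivalence with `p` as a retract. Cancellation on the
other side is never needed. -/

lemma homotopicRel_of_convex (hs : Convex ℝ s) (e : X ≃ₜ s) (f g : C(Y, X)) (S : Set Y)
    (h : Set.EqOn f g S) : f.HomotopicRel g S := by
  refine ⟨{ toFun := fun p ↦ e.symm ⟨AffineMap.lineMap (k := ℝ) (e (f p.2) : E) (e (g p.2) : E)
              (p.1 : ℝ), hs.lineMap_mem (e _).2 (e _).2 p.1.2⟩
            continuous_toFun := ?_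
            map_zero_left := fun y ↦ by simp
            map_one_left := fun y ↦ by simp
            prop' := fun t y hy ↦ by simp [h hy] }⟩
  simp only [AffineMap.lineMap_apply_module]
  fun_prop

lemma subsingleton_zerothHomotopy_of_convex (hs : Convex ℝ s) (e : X ≃ₜ s) :
    Subsingleton (ZerothHomotopy X) := by
  refine ⟨fun a b ↦ ?_⟩
  induction a using Quotient.inductionOn with | _ a
  induction b using Quotient.inductionOn with | _ b
  obtain ⟨H⟩ := homotopicRel_of_convex hs e (.const Unit a) (.const Unit b) ∅ (by simp)
  exact Quotient.sound ⟨H.toHomotopy.evalAt ()⟩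

lemma subsingleton_homotopyGroup_of_convex (hs : Convex ℝ s) (e : X ≃ₜ s) (N : Type*) (x : X) :
    Subsingleton (HomotopyGroup N X x) := by
  refine ⟨fun a b ↦ ?_⟩
  induction a using Quotient.inductionOn with | _ a
  induction b using Quotient.inductionOn with | _ b
  exact Quotient.sound (homotopicRel_of_convex hs e a.1 b.1 _
    (fun y hy ↦ (a.2 y hy).trans (b.2 y hy).symm))

variable {F : Type*} [AddCommGroup F] [Module ℝ F] [TopologicalSpace F]
  [IsTopologicalAddGroup F] [ContinuousSMul ℝ F] {t : Set F}

/-- Straight-line homotopies trivialize all invariants of source and target, so nothing is asked of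
`f`; nonemptiness gives surjectivity on path components. -/
lemma isWeakHomotopyEquivalence_of_convex [Nonempty X] (hs : Convex ℝ s) (ht : Convex ℝ t)
    (e : X ≃ₜ s) (e' : Y ≃ₜ t) (f : C(X, Y)) : IsWeakHomotopyEquivalence f where
  bijective_zerothHomotopy := by
    have := subsingleton_zerothHomotopy_of_convex hs e
    have := subsingleton_zerothHomotopy_of_convex ht e'
    exact ⟨Function.injective_of_subsingleton _,
      fun y ↦ ⟨Quotient.mk _ (Classical.arbitrary X), Subsingleton.elim _ _⟩⟩
  bijective_homotopyGroup n x := by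
    have := subsingleton_homotopyGroup_of_convex hs e (Fin (n + 1)) x
    have := subsingleton_homotopyGroup_of_convex ht e' (Fin (n + 1)) (f x)
    exact ⟨Function.injective_of_subsingleton _, fun y ↦ ⟨default, Subsingleton.elim _ _⟩⟩

end

/-! ### The endpoints of the interval `Δ[1]` -/

/-- The inclusion of an endpoint in `Δ[1]`, as a morphism from the unit object. -/
def endpoint (k : Fin 2) : 𝟙_ SSet.{u} ⟶ Δ[1] :=
  (SSet.unitHomEquiv _).symm (SSet.stdSimplex.obj₀Equiv.symm k)

instance (n : SimplexCategoryᵒᵖ) : Unique ((𝟙_ SSet.{u}).obj n) :=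
  inferInstanceAs (Unique PUnit)

instance mono_endpoint (k : Fin 2) : Mono (endpoint.{u} k) := by
  have (n : SimplexCategoryᵒᵖ) : Mono ((endpoint.{u} k).app n) := by
    rw [mono_iff_injective]
    exact Function.injective_of_subsingleton _
  exact NatTrans.mono_of_mono_app _

lemma endpoint_app_ne (n : SimplexCategoryᵒᵖ) (x y : (𝟙_ SSet.{u}).obj n) :
    (endpoint 0).app n x ≠ (endpoint 1).app n y := by
  intro h
  -- An endpoint gives a constant simplex in each degree, so its value at the vertex `0` tells the
  -- two apart.
  have : (0 : Fin 2) = 1 := congr_arg (fun s ↦ SSet.stdSimplex.objEquiv s |>.toOrderHom 0) h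
  exact absurd this (by decide)

/-- The inclusion in `Δ[1]` of the disjoint union of its endpoints. -/
noncomputable def endpoints : 𝟙_ SSet.{u} ⨿ 𝟙_ SSet.{u} ⟶ Δ[1] :=
  coprod.desc (endpoint 0) (endpoint 1)

instance mono_endpoints : Mono endpoints.{u} := by
  have (n : SimplexCategoryᵒᵖ) : Mono (endpoints.{u}.app n) := by
    rw [mono_iff_injective]
    have h₀ (x) : endpoints.app n ((coprod.inl : 𝟙_ SSet.{u} ⟶ _).app n x) =
        (endpoint 0).app n x := by
      rw [← NatTrans.comp_app_apply, endpoints, coprod.inl_desc]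
    have h₁ (x) : endpoints.app n ((coprod.inr : 𝟙_ SSet.{u} ⟶ _).app n x) =
        (endpoint 1).app n x := by
      rw [← NatTrans.comp_app_apply, endpoints, coprod.inr_desc]
    have h (z : (𝟙_ SSet.{u} ⨿ 𝟙_ SSet.{u}).obj n) :
        (∃ x, z = (coprod.inl : 𝟙_ SSet.{u} ⟶ _).app n x) ∨
          ∃ x, z = (coprod.inr : 𝟙_ SSet.{u} ⟶ _).app n x := by
      -- Coproducts of simplicial sets are computed degreewise.
      obtain ⟨⟨_ | _⟩, x, rfl⟩ := Types.jointly_surjective_of_isColimit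
        (isColimitOfPreserves ((evaluation _ _).obj n)
          (colimit.isColimit (pair (𝟙_ SSet.{u}) (𝟙_ SSet.{u})))) z
      · exact Or.inl ⟨x, rfl⟩
      · exact Or.inr ⟨x, rfl⟩
    intro a b hab
    obtain ⟨x, rfl⟩ | ⟨x, rfl⟩ := h a <;> obtain ⟨y, rfl⟩ | ⟨y, rfl⟩ := h b <;>
      simp only [h₀, h₁] at hab
    · rw [Subsingleton.elim x y]
    · exact (endpoint_app_ne _ _ _ hab).elim
    · exact (endpoint_app_ne _ _ _ hab.symm).elim
    · rw [Subsingleton.elim x y]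
  exact NatTrans.mono_of_mono_app _

instance cofibration_of_mono {X Y : SSet.{u}} (f : X ⟶ Y) [Mono f] : Cofibration f :=
  ⟨MorphismProperty.monomorphisms.infer_property f⟩

/-- The realization of the unit object is a point. -/
noncomputable def toTopUnitHomeo :
    |(𝟙_ SSet.{u})| ≃ₜ stdSimplex ℝ (Fin (⦋0⦌.len + 1)) :=
  (TopCat.homeoOfIso (SSet.toTop.mapIso
    (SSet.stdSimplex.isTerminalObj₀.uniqueUpToIso
      CartesianMonoidalCategory.isTerminalTensorUnit))).symm.trans ⦋0⦌.toTopHomeo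

instance weakEquivalence_endpoint (k : Fin 2) : WeakEquivalence (endpoint.{u} k) := by
  have : Nonempty |(𝟙_ SSet.{u})| := toTopUnitHomeo.toEquiv.nonempty
  exact ⟨isWeakHomotopyEquivalence_of_convex (convex_stdSimplex _ _) (convex_stdSimplex _ _)
    toTopUnitHomeo ⦋1⦌.toTopHomeo _⟩

/-- The face `δ i` omits the vertex `i`, so the vertex `k` of an edge is its face of index `1 - k`;
hence `k.rev`. -/
lemma yonedaEquiv_map_δ {X : SSet.{u}} (φ : Δ[1] ⟶ X) (k : Fin 2) :
    X.map (SimplexCategory.δ k.rev).op (SSet.yonedaEquiv φ) =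
      SSet.unitHomEquiv _ (endpoint k ≫ φ) := by
  obtain ⟨e, rfl⟩ := SSet.yonedaEquiv.symm.surjective φ
  have h : SimplexCategory.δ k.rev =
      SSet.stdSimplex.objEquiv (SSet.unitHomEquiv _ (endpoint.{u} k)) := by
    rw [endpoint, Equiv.apply_symm_apply]
    ext i
    fin_cases i
    fin_cases k <;> rfl
  rw [Equiv.apply_symm_apply, h]
  rfl

lemma π₀Rel_iff {X : SSet.{u}} (x₀ x₁ : 𝟙_ SSet.{u} ⟶ X) :
    SSet.π₀Rel (X.unitHomEquiv x₀) (X.unitHomEquiv x₁) ↔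
      ∃ φ : Δ[1] ⟶ X, endpoint 0 ≫ φ = x₀ ∧ endpoint 1 ≫ φ = x₁ := by
  constructor
  · rintro ⟨e⟩
    refine ⟨SSet.yonedaEquiv.symm e.edge, ?_, ?_⟩ <;> apply X.unitHomEquiv.injective <;>
      rw [← yonedaEquiv_map_δ, Equiv.apply_symm_apply]
    · exact e.src_eq
    · exact e.tgt_eq
  · rintro ⟨φ, rfl, rfl⟩
    exact ⟨.mk (SSet.yonedaEquiv φ) (yonedaEquiv_map_δ φ 0) (yonedaEquiv_map_δ φ 1)⟩

/-! ### Homotopies parametrized by `Δ[1]` -/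

section

variable (C : Type u) [Category.{v} C] [MonoidalLeftAction SSet.{v} C]

/-- Two morphisms `A ⟶ B` are related if they are the endpoints of a map `Δ[1] ⊗ A ⟶ B`. -/
def elementaryHomotopy : HomRel C := fun A B f g ↦
  ∃ H : (Δ[1] : SSet.{v}) ⊙ₗ A ⟶ B,
    endpoint 0 ⊵ₗ A ≫ H = (λₗ A).hom ≫ f ∧ endpoint 1 ⊵ₗ A ≫ H = (λₗ A).hom ≫ g

instance : (elementaryHomotopy C).IsStableUnderPrecomp where
  comp_left := by
    rintro A B D f g g' ⟨H, h₀, h₁⟩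
    exact ⟨Δ[1] ⊴ₗ f ≫ H, by simp [← action_exchange_assoc, h₀], by
      simp [← action_exchange_assoc, h₁]⟩

instance : (elementaryHomotopy C).IsStableUnderPostcomp where
  comp_right := by
    rintro A B D f f' g ⟨H, h₀, h₁⟩
    exact ⟨H ≫ g, by simp [reassoc_of% h₀], by simp [reassoc_of% h₁]⟩

/-- The functor to the category with the same objects, and homotopy classes as morphisms. -/
abbrev toHomotopyClasses : C ⥤ CategoryTheory.Quotient (elementaryHomotopy C) :=
  Quotient.functor _

variable {C} {A B : C}

/-- Stability under composition on both sides means that no closure beyond the generated equivalence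
relation is needed. -/
lemma toHomotopyClasses_map_eq_iff (f g : A ⟶ B) :
    (toHomotopyClasses C).map f = (toHomotopyClasses C).map g ↔
      Relation.EqvGen (elementaryHomotopy C (X := A) (Y := B)) f g := by
  have := Quotient.functor_homRel_eq_compClosure_eqvGen (elementaryHomotopy C) f g
  rwa [HomRel.compClosure_eq_self, Functor.homRel_iff] at this

/-- The constant homotopy. -/
def constHomotopy (f : A ⟶ B) : (Δ[1] : SSet.{v}) ⊙ₗ A ⟶ B :=
  SemiCartesianMonoidalCategory.toUnit Δ[1] ⊵ₗ A ≫ (λₗ A).hom ≫ f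

lemma endpoint_constHomotopy (k : Fin 2) (f : A ⟶ B) :
    endpoint k ⊵ₗ A ≫ constHomotopy f = (λₗ A).hom ≫ f := by
  rw [constHomotopy, ← comp_actionHomLeft_assoc,
    SemiCartesianMonoidalCategory.toUnit_unique (endpoint k ≫ _) (𝟙 _), id_actionHomLeft,
    Category.id_comp]

lemma _root_.Relation.EqvGen.iff_of_rel {α : Type*} {r : α → α → Prop} {P : α → Prop}
    (hP : ∀ a b, r a b → (P a ↔ P b)) {a b : α} (h : Relation.EqvGen r a b) : P a ↔ P b := by
  induction h with
  | rel a b h => exact hP a b h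
  | refl => rfl
  | symm a b _ h => exact h.symm
  | trans a b c _ _ h h' => exact h.trans h'

lemma _root_.Relation.EqvGen.map_of_rel {α β : Type*} {r : α → α → Prop} {s : β → β → Prop}
    (φ : α → β) (hφ : ∀ a b, r a b → s (φ a) (φ b)) {a b : α} (h : Relation.EqvGen r a b) :
    Relation.EqvGen s (φ a) (φ b) := by
  induction h with
  | rel a b h => exact .rel _ _ (hφ a b h)
  | refl => exact .refl _
  | symm a b _ h => exact h.symm
  | trans a b c _ _ h h' => exact h.trans _ _ _ h'

variable (T : TwoVariableAdjunction (curriedAction SSet.{v} C))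

include T in
-- Tensoring with `A` is a left adjoint, so it preserves the coproduct of the two endpoints.
lemma endpoints_hom_ext {f g : (𝟙_ SSet.{v} ⨿ 𝟙_ SSet.{v}) ⊙ₗ A ⟶ B}
    (h₀ : coprod.inl ⊵ₗ A ≫ f = coprod.inl ⊵ₗ A ≫ g)
    (h₁ : coprod.inr ⊵ₗ A ≫ f = coprod.inr ⊵ₗ A ≫ g) : f = g := by
  apply T.curry.injective
  ext1 <;> rw [T.curry_comp, T.curry_comp] <;> congr 1

lemma π₀Rel_homEquiv'_iff (f g : A ⟶ B) :
    letI := T.simplicialCategory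
    SSet.π₀Rel (SimplicialCategory.homEquiv' A B f) (SimplicialCategory.homEquiv' A B g) ↔
      elementaryHomotopy C f g := by
  -- By definition, the vertex attached to `f` is the transpose of `𝟙_ ⊗ A ≅ A ⟶ B`.
  refine (π₀Rel_iff (T.curry ((λₗ A).hom ≫ f)) (T.curry ((λₗ A).hom ≫ g))).trans ?_
  constructor
  · rintro ⟨φ, h₀, h₁⟩
    obtain ⟨H, rfl⟩ := T.curry.surjective φ
    rw [T.curry_comp] at h₀ h₁
    exact ⟨H, T.curry.injective h₀, T.curry.injective h₁⟩
  · rintro ⟨H, h₀, h₁⟩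
    exact ⟨T.curry H, by rw [T.curry_comp, h₀], by rw [T.curry_comp, h₁]⟩

lemma areSimpliciallyHomotopic_iff (f g : A ⟶ B) :
    letI := T.simplicialCategory
    AreSimpliciallyHomotopic f g ↔
      (toHomotopyClasses C).map f = (toHomotopyClasses C).map g := by
  let := T.simplicialCategory
  rw [toHomotopyClasses_map_eq_iff, AreSimpliciallyHomotopic, SSet.π₀.mk_eq_mk_iff]
  refine ⟨fun h ↦ ?_, fun h ↦ h.map_of_rel _ fun a b ↦ (π₀Rel_homEquiv'_iff T a b).2⟩
  have := h.map_of_rel (s := elementaryHomotopy C (X := A) (Y := B))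
    (SimplicialCategory.homEquiv' A B).symm fun a b hab ↦ by
      rw [← π₀Rel_homEquiv'_iff T]
      simpa only [Equiv.apply_symm_apply] using hab
  simpa only [Equiv.symm_apply_apply] using this

lemma isSimplicialEquivalence_iff (f : A ⟶ B) :
    letI := T.simplicialCategory
    IsSimplicialEquivalence f ↔ IsIso ((toHomotopyClasses C).map f) := by
  let := T.simplicialCategory
  simp only [IsSimplicialEquivalence, areSimpliciallyHomotopic_iff T, Functor.map_comp,
    CategoryTheory.Functor.map_id]
  constructor
  · rintro ⟨g, h₀, h₁⟩
    exact ⟨_, h₀, h₁⟩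
  · rintro ⟨g, h₀, h₁⟩
    obtain ⟨g, rfl⟩ := (toHomotopyClasses C).map_surjective g
    exact ⟨g, h₀, h₁⟩

end

/-! ### Homotopies and lifting properties -/

section

variable {C : Type u} [Category.{v} C] [CategoryWithCofibrations C] [CategoryWithFibrations C]
  [CategoryWithWeakEquivalences C] [IsAlmostModelCategory C]

lemma hasLiftingProperty_of_or {L K E B : C} (i : L ⟶ K) (p : E ⟶ B) [Cofibration i]
    [Fibration p] (h : WeakEquivalence i ∨ WeakEquivalence p) : HasLiftingProperty i p := by
  obtain h | h := h
  · exact IsAlmostModelCategory.trivialCofibrations_lift _ (mem_trivialCofibrations i) p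
      (mem_fibrations p)
  · exact IsAlmostModelCategory.cofibrations_lift _ (mem_cofibrations i) p
      (mem_trivialFibrations p)

lemma isCofibrant_of_cof {A X : C} (i : A ⟶ X) [hA : IsCofibrant A] [Cofibration i] :
    IsCofibrant X := by
  have := IsAlmostModelCategory.cofibrations_multiplicative (C := C)
  rw [isCofibrant_iff, Subsingleton.elim (initial.to X) (initial.to A ≫ i)]
  exact ⟨(cofibrations C).comp_mem _ _ hA.mem (mem_cofibrations i)⟩

lemma isFibrant_of_fib {X B : C} (p : X ⟶ B) [hB : IsFibrant B] [Fibration p] :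
    IsFibrant X := by
  have := IsAlmostModelCategory.fibrations_multiplicative (C := C)
  rw [isFibrant_iff, Subsingleton.elim (terminal.from X) (p ≫ terminal.from B)]
  exact ⟨(fibrations C).comp_mem _ _ (mem_fibrations p) hB.mem⟩

variable [MonoidalLeftAction SSet.{v} C] (Q : LeftQuillenBifunctor (curriedAction SSet.{v} C))

include Q

lemma exists_pushoutProduct {X Y : SSet.{v}} (j : X ⟶ Y) {L K : C} (i : L ⟶ K)
    [Cofibration j] [Cofibration i] :
    ∃ (P : C) (inl : Y ⊙ₗ L ⟶ P) (inr : X ⊙ₗ K ⟶ P) (ι : P ⟶ Y ⊙ₗ K),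
      IsPushout (j ⊵ₗ L) (X ⊴ₗ i) inl inr ∧ inl ≫ ι = Y ⊴ₗ i ∧ inr ≫ ι = j ⊵ₗ K ∧
        Cofibration ι ∧ (WeakEquivalence i → WeakEquivalence ι) := by
  let sq : (curriedAction SSet.{v} C).PushoutObjObj j i := .ofHasPushout _ _ _
  exact ⟨sq.pt, sq.inl, sq.inr, sq.ι, sq.isPushout, sq.inl_ι, sq.inr_ι,
    Q.cofibration_ι _ _ sq inferInstance inferInstance,
    fun h ↦ Q.weakEquivalence_ι _ _ sq inferInstance inferInstance (.inr h)⟩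

/-- A homotopy prescribed on `L`, at both ends and after projection to `B` is a lifting problem for
the pushout product `ι` of `endpoints` and `i` against `p`. It is solvable since `ι` is a
cofibration, trivial when `i` is. -/
lemma exists_homotopy_lift {L K E B : C} (i : L ⟶ K) (p : E ⟶ B) [Cofibration i] [Fibration p]
    (h : WeakEquivalence i ∨ WeakEquivalence p) (u₀ u₁ : K ⟶ E)
    (HL : (Δ[1] : SSet.{v}) ⊙ₗ L ⟶ E) (HK : (Δ[1] : SSet.{v}) ⊙ₗ K ⟶ B)
    (hL₀ : endpoint 0 ⊵ₗ L ≫ HL = (λₗ L).hom ≫ i ≫ u₀)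
    (hL₁ : endpoint 1 ⊵ₗ L ≫ HL = (λₗ L).hom ≫ i ≫ u₁)
    (hK₀ : endpoint 0 ⊵ₗ K ≫ HK = (λₗ K).hom ≫ u₀ ≫ p)
    (hK₁ : endpoint 1 ⊵ₗ K ≫ HK = (λₗ K).hom ≫ u₁ ≫ p)
    (w : Δ[1] ⊴ₗ i ≫ HK = HL ≫ p) :
    elementaryHomotopy C u₀ u₁ := by
  obtain ⟨P, inl, inr, ι, sq, inl_ι, inr_ι, _, hι⟩ := exists_pushoutProduct Q endpoints.{v} i
  let U : (𝟙_ SSet.{v} ⨿ 𝟙_ SSet.{v}) ⊙ₗ K ⟶ E :=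
    Q.curry.symm (coprod.desc (Q.curry ((λₗ K).hom ≫ u₀)) (Q.curry ((λₗ K).hom ≫ u₁)))
  have hU₀ : coprod.inl ⊵ₗ K ≫ U = (λₗ K).hom ≫ u₀ := Q.curry.injective (by
    rw [← Q.curry_comp, Equiv.apply_symm_apply, coprod.inl_desc])
  have hU₁ : coprod.inr ⊵ₗ K ≫ U = (λₗ K).hom ≫ u₁ := Q.curry.injective (by
    rw [← Q.curry_comp, Equiv.apply_symm_apply, coprod.inr_desc])
  have h₀ (X : C) : endpoint 0 ⊵ₗ X = coprod.inl ⊵ₗ X ≫ endpoints.{v} ⊵ₗ X := by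
    rw [← comp_actionHomLeft, endpoints, coprod.inl_desc]
  have h₁ (X : C) : endpoint 1 ⊵ₗ X = coprod.inr ⊵ₗ X ≫ endpoints.{v} ⊵ₗ X := by
    rw [← comp_actionHomLeft, endpoints, coprod.inr_desc]
  have hLU : endpoints ⊵ₗ L ≫ HL = (𝟙_ SSet.{v} ⨿ 𝟙_ SSet.{v}) ⊴ₗ i ≫ U := by
    apply endpoints_hom_ext Q.toTwoVariableAdjunction
    · rw [← action_exchange_assoc, hU₀, ← reassoc_of% h₀, hL₀]
      simp
    · rw [← action_exchange_assoc, hU₁, ← reassoc_of% h₁, hL₁]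
      simp
  have hUK : endpoints ⊵ₗ K ≫ HK = U ≫ p := by
    apply endpoints_hom_ext Q.toTwoVariableAdjunction
    · rw [← reassoc_of% h₀, reassoc_of% hU₀, hK₀]
    · rw [← reassoc_of% h₁, reassoc_of% hU₁, hK₁]
  have := hasLiftingProperty_of_or ι p (h.imp_left hι)
  have comm : CommSq (sq.desc HL U hLU) ι p HK := ⟨by
    apply sq.hom_ext
    · rw [sq.inl_desc_assoc, reassoc_of% inl_ι, w]
    · rw [sq.inr_desc_assoc, reassoc_of% inr_ι, hUK]⟩
  have hlift : endpoints ⊵ₗ K ≫ comm.lift = U := by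
    rw [← inr_ι, Category.assoc, comm.fac_left, sq.inr_desc]
  exact ⟨comm.lift, by rw [h₀, Category.assoc, hlift, hU₀], by
    rw [h₁, Category.assoc, hlift, hU₁]⟩

/-- Fibrancy of `A` gives a retraction `r` of `i`. Since `i ∘ r` and the identity agree on `A`, the
constant homotopy there extends to `X`, which is fibrant. -/
lemma isIso_toHomotopyClasses_of_trivialCofibration {A X : C} (i : A ⟶ X) [Cofibration i]
    [WeakEquivalence i] [IsFibrant A] [IsFibrant X] :
    IsIso ((toHomotopyClasses C).map i) := by
  have := hasLiftingProperty_of_or i (terminal.from A) (.inl inferInstance)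
  have sq : CommSq (𝟙 A) i (terminal.from A) (terminal.from X) := ⟨Subsingleton.elim _ _⟩
  have fac : i ≫ sq.lift = 𝟙 A := sq.fac_left
  refine ⟨(toHomotopyClasses C).map sq.lift, ?_, ?_⟩
  · rw [← Functor.map_comp, fac, CategoryTheory.Functor.map_id]
  · rw [← Functor.map_comp, ← CategoryTheory.Functor.map_id, toHomotopyClasses_map_eq_iff]
    refine .rel _ _ (exists_homotopy_lift Q i (terminal.from X) (.inl inferInstance) _ _
      (constHomotopy i) (terminal.from _) ?_ ?_ ?_ ?_ ?_)
    · rw [endpoint_constHomotopy, reassoc_of% fac]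
    · rw [endpoint_constHomotopy, Category.comp_id]
    all_goals exact Subsingleton.elim _ _

/-- Dually, `p` has a section `s`, and `s ∘ p` and the identity agree after projection to `B`; the
constant homotopy there lifts to `X`, which is cofibrant. -/
lemma isIso_toHomotopyClasses_of_trivialFibration {X B : C} (p : X ⟶ B) [Fibration p]
    [WeakEquivalence p] [IsCofibrant X] [IsCofibrant B] :
    IsIso ((toHomotopyClasses C).map p) := by
  have := hasLiftingProperty_of_or (initial.to B) p (.inr inferInstance)
  have sq : CommSq (initial.to X) (initial.to B) p (𝟙 B) := ⟨Subsingleton.elim _ _⟩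
  have fac : sq.lift ≫ p = 𝟙 B := sq.fac_right
  -- `K ⊗ -` is a left adjoint, so the conditions over the initial object are vacuous.
  have hinit (K : SSet.{v}) : IsInitial (K ⊙ₗ ⊥_ C) := by
    have := (Q.adjL.adj K).leftAdjoint_preservesColimits
    exact IsInitial.isInitialObj ((curriedAction SSet.{v} C).obj K) _ initialIsInitial
  refine ⟨(toHomotopyClasses C).map sq.lift, ?_, ?_⟩
  · rw [← Functor.map_comp, ← CategoryTheory.Functor.map_id, toHomotopyClasses_map_eq_iff]
    refine .rel _ _ (exists_homotopy_lift Q (initial.to X) p (.inr inferInstance) _ _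
      ((hinit _).to _) (constHomotopy p) ?_ ?_ ?_ ?_ ?_)
    · exact (hinit _).hom_ext _ _
    · exact (hinit _).hom_ext _ _
    · rw [endpoint_constHomotopy, Category.assoc, fac, Category.comp_id]
    · rw [endpoint_constHomotopy, Category.id_comp]
    · exact (hinit _).hom_ext _ _
  · rw [← Functor.map_comp, fac, CategoryTheory.Functor.map_id]

/-- For cofibrant `A`, this map is the pushout product of the endpoint with `∅ ⟶ A`. -/
lemma trivialCofibration_endpoint_action (k : Fin 2) (A : C) [IsCofibrant A] :
    Cofibration (endpoint.{v} k ⊵ₗ A) ∧ WeakEquivalence (endpoint.{v} k ⊵ₗ A) := by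
  have (K : SSet.{v}) := (Q.adjL.adj K).leftAdjoint_preservesColimits
  let sq := Functor.PushoutObjObj.ofIsInitialRight (curriedAction SSet.{v} C) (endpoint k)
    (initial.to A) initialIsInitial
  exact ⟨Q.cofibration_ι _ _ sq inferInstance inferInstance,
    Q.weakEquivalence_ι _ _ sq inferInstance inferInstance (.inl inferInstance)⟩

lemma exists_lift_of_homotopic {A X B : C} (p : X ⟶ B) [Fibration p] [IsCofibrant A]
    (s : A ⟶ X) {f : A ⟶ B}
    (h : (toHomotopyClasses C).map (s ≫ p) = (toHomotopyClasses C).map f) :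
    ∃ t : A ⟶ X, t ≫ p = f ∧ (toHomotopyClasses C).map s = (toHomotopyClasses C).map t := by
  have key (t : A ⟶ X) (H : (Δ[1] : SSet.{v}) ⊙ₗ A ⟶ B) (k : Fin 2)
      (h : endpoint k ⊵ₗ A ≫ H = (λₗ A).hom ≫ t ≫ p) :
      ∃ G : (Δ[1] : SSet.{v}) ⊙ₗ A ⟶ X, endpoint k ⊵ₗ A ≫ G = (λₗ A).hom ≫ t ∧ G ≫ p = H := by
    obtain ⟨_, hk⟩ := trivialCofibration_endpoint_action Q k A
    have := hasLiftingProperty_of_or (endpoint.{v} k ⊵ₗ A) p (.inl hk)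
    have sq : CommSq ((λₗ A).hom ≫ t) (endpoint.{v} k ⊵ₗ A) p H := ⟨by simp [h]⟩
    exact ⟨sq.lift, sq.fac_left, sq.fac_right⟩
  rw [toHomotopyClasses_map_eq_iff] at h
  -- The lift is carried along the chain of elementary homotopies; each may be traversed in either
  -- direction, as both endpoint inclusions are trivial cofibrations.
  refine (h.iff_of_rel (P := fun f ↦ ∃ t : A ⟶ X, t ≫ p = f ∧
    (toHomotopyClasses C).map s = (toHomotopyClasses C).map t) ?_).1 ⟨s, rfl, rfl⟩
  rintro a b ⟨H, h₀, h₁⟩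
  constructor
  · rintro ⟨t, rfl, ht⟩
    obtain ⟨G, hG, rfl⟩ := key t H 0 h₀
    refine ⟨(λₗ A).inv ≫ endpoint 1 ⊵ₗ A ≫ G, by simp [h₁], ht.trans ?_⟩
    exact (toHomotopyClasses_map_eq_iff _ _).2 (.rel _ _ ⟨G, hG, by simp⟩)
  · rintro ⟨t, rfl, ht⟩
    obtain ⟨G, hG, rfl⟩ := key t H 1 h₁
    refine ⟨(λₗ A).inv ≫ endpoint 0 ⊵ₗ A ≫ G, by simp [h₀], ht.trans ?_⟩
    exact ((toHomotopyClasses_map_eq_iff _ _).2 (.rel _ _ ⟨G, by simp, hG⟩)).symm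

end

/-! ### Weak equivalences and homotopy classes in a right model category -/

section

variable {C : Type u} [Category.{v} C] [CategoryWithCofibrations C] [CategoryWithFibrations C]
  [CategoryWithWeakEquivalences C] [IsRightModelCategory C]

lemma weakEquivalence_of_isIso {A B : C} (f : A ⟶ B) [IsIso f] : WeakEquivalence f :=
  ⟨IsRightModelCategory.isomorphisms_le _ (MorphismProperty.isomorphisms.infer_property f)⟩

variable [MonoidalLeftAction SSet.{v} C] (Q : LeftQuillenBifunctor (curriedAction SSet.{v} C))

include Q

/-- If one end of a homotopy `H` is a weak equivalence, cancelling the endpoint inclusion shows that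
`H` is one; restricting `H` to the other end and cancelling the unit isomorphism gives the claim. -/
lemma weakEquivalence_iff_of_homotopic {A B : C} [IsCofibrant A] {f g : A ⟶ B}
    (h : (toHomotopyClasses C).map f = (toHomotopyClasses C).map g) :
    WeakEquivalence f ↔ WeakEquivalence g := by
  have key (a b : A ⟶ B) (H : (Δ[1] : SSet.{v}) ⊙ₗ A ⟶ B) (k l : Fin 2)
      (hk : endpoint k ⊵ₗ A ≫ H = (λₗ A).hom ≫ a) (hl : endpoint l ⊵ₗ A ≫ H = (λₗ A).hom ≫ b)
      (ha : WeakEquivalence a) : WeakEquivalence b := by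
    have hunit := weakEquivalence_of_isIso (λₗ[SSet.{v}] A).hom
    have hH : WeakEquivalence H := IsRightModelCategory.weakEquivalence_of_precomp _ _
      (trivialCofibration_endpoint_action Q k A).2 (by
        rw [hk]
        exact IsRightModelCategory.weakEquivalence_comp _ _ hunit ha)
    refine IsRightModelCategory.weakEquivalence_of_precomp _ _ hunit ?_
    rw [← hl]
    exact IsRightModelCategory.weakEquivalence_comp _ _ (trivialCofibration_endpoint_action Q l A).2 hH
  rw [toHomotopyClasses_map_eq_iff] at h
  exact h.iff_of_rel fun a b ⟨H, h₀, h₁⟩ ↦ ⟨key a b H 0 1 h₀ h₁, key b a H 1 0 h₁ h₀⟩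

lemma weakEquivalence_of_fibration {X B : C} (p : X ⟶ B) [Fibration p] [IsCofibrant X]
    [IsCofibrant B] [IsIso ((toHomotopyClasses C).map p)] : WeakEquivalence p := by
  obtain ⟨g, hg⟩ := (toHomotopyClasses C).map_surjective (inv ((toHomotopyClasses C).map p))
  -- The homotopy inverse `g` is deformed to a strict section `s` of `p`.
  obtain ⟨s, hs, hgs⟩ := exists_lift_of_homotopic Q p g (f := 𝟙 B) (by simp [hg])
  have hps : WeakEquivalence (p ≫ s) :=
    (weakEquivalence_iff_of_homotopic Q (by simp [← hgs, hg])).1 (weakEquivalence_of_isIso (𝟙 X))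
  have := IsAlmostModelCategory.weakEquivalences_retracts (C := C)
  -- The retract is the identity on sources; on targets it is `B ⟶ X ⟶ B`, given by `s` and then
  -- `p`.
  let r : RetractArrow p (p ≫ s) :=
    { i := Arrow.homMk (𝟙 X) s
      r := Arrow.homMk (𝟙 X) p (by simp [hs])
      retract := by ext <;> simp [hs] }
  exact ⟨MorphismProperty.of_retract r hps.mem⟩

lemma weakEquivalence_iff_isIso_toHomotopyClasses {A B : C} [IsFibrant A] [IsCofibrant A]
    [IsFibrant B] [IsCofibrant B] (f : A ⟶ B) :
    WeakEquivalence f ↔ IsIso ((toHomotopyClasses C).map f) := by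
  have := IsAlmostModelCategory.factorization_trivialCofibrations (C := C)
  let F := MorphismProperty.factorizationData (trivialCofibrations C) (fibrations C) f
  obtain ⟨_, hi⟩ := (mem_trivialCofibrations_iff F.i).1 F.hi
  have : Fibration F.p := ⟨F.hp⟩
  have := isCofibrant_of_cof F.i
  have := isFibrant_of_fib F.p
  have := isIso_toHomotopyClasses_of_trivialCofibration Q F.i
  rw [← F.fac]
  constructor
  · intro h
    have := IsRightModelCategory.weakEquivalence_of_precomp _ _ hi h
    have := isIso_toHomotopyClasses_of_trivialFibration Q F.p
    rw [Functor.map_comp]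
    infer_instance
  · intro h
    rw [Functor.map_comp] at h
    have := IsIso.of_isIso_comp_left ((toHomotopyClasses C).map F.i) ((toHomotopyClasses C).map F.p)
    exact IsRightModelCategory.weakEquivalence_comp _ _ hi (weakEquivalence_of_fibration Q F.p)

end

end AlmostModel

open AlmostModel
theorem propositionp (C : Type u) [Category.{v} C] [CategoryWithCofibrations C]
    [CategoryWithFibrations C] [CategoryWithWeakEquivalences C] [IsRightModelCategory C]
    [SimplicialAlmostModelCategory C] (A B : C) [IsFibrant A] [IsCofibrant A]
    [IsFibrant B] [IsCofibrant B] (f : A ⟶ B) :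
    WeakEquivalence f ↔ IsSimplicialHomotopyEquivalence f :=
  let Q := SimplicialAlmostModelCategory.leftQuillen (C := C)
  (weakEquivalence_iff_isIso_toHomotopyClasses Q f).trans
    (isSimplicialEquivalence_iff Q.toTwoVariableAdjunction f).symm
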